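/- Let $X$ be a real $3$-dimensional vector space equipped with a norm $\|\cdot\|$. For $p>0$, call a set $S\subseteq X$ $p$-equilateral if $\|x-y\|=p$ for all $x,y\in S$ with $x\neq y$, and call $S$ equilateral if it is $p$-equilateral for some $p>0$. If three distinct points $a,b,c\in X$ form a $p$-equilateral set, then there exists $d\in X$ such that $$\|d-a\|=\|d-b\|=\|d-c\|=p.$$ In other words, every equilateral set of $3$ elements in $X$ can be extended to an equilateral set of $4$ elements. -/

import Mathlib

/-- `S` is a `p`-equilateral set: `p > 0` and any two distinct points of `S` are at distance
`p` in the norm. -/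
def IsEquilateralWith {X : Type*} [NormedAddCommGroup X] (p : ℝ) (S : Set X) : Prop :=
  0 < p ∧ ∀ x ∈ S, ∀ y ∈ S, x ≠ y → ‖x - y‖ = p

/-- `S` is equilateral: it is `p`-equilateral for some `p > 0`. -/
def IsEquilateral {X : Type*} [NormedAddCommGroup X] (S : Set X) : Prop :=
  ∃ p : ℝ, IsEquilateralWith p S

/-! Translate `a` to `0` and put `u = b - a`. It suffices that `E = equidistantSet p u` is
connected: the distance to `c - a` is `0` at `c - a ∈ E` and at least `p` at its mirror image `u -
(c - a) ∈ E`, so it takes the value `p` on `E`. For connectedness, project along `u` onto a plane.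
The projection never vanishes on `E`, so normalising it maps the compact set `E` to the unit circle.
Every fibre is nonempty (`exists_mem_ray`) and convex (`convex_ray`), and the circle is connected.
-/

/-- Along a line, the norm is strictly below `p` strictly before the second of two points
where it is `< p` and `≤ p` respectively. -/
theorem norm_add_smul_lt {X : Type*} [NormedAddCommGroup X] [NormedSpace ℝ X] {p : ℝ} {x u : X}
    {r s t : ℝ} (hr : ‖x + r • u‖ < p) (ht : ‖x + t • u‖ ≤ p)
    (h : (r ≤ s ∧ s < t) ∨ (t < s ∧ s ≤ r)) : ‖x + s • u‖ < p := by
  have hne : t - r ≠ 0 := by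
    rcases h with h | h
    · exact (sub_pos.2 (h.1.trans_lt h.2)).ne'
    · exact (sub_neg.2 (h.1.trans_le h.2)).ne
  obtain ⟨θ, hθ, h0, h1⟩ : ∃ θ : ℝ, s = (1 - θ) * r + θ * t ∧ 0 ≤ θ ∧ θ < 1 := by
    refine ⟨(s - r) / (t - r), by field_simp; ring, ?_, ?_⟩
    · rcases h with h | h
      · exact div_nonneg (by linarith) (by linarith)
      · exact div_nonneg_of_nonpos (by linarith) (by linarith)
    · rcases h with h | h
      · rw [div_lt_one (by linarith)]; linarith
      · rw [div_lt_one_of_neg (by linarith)]; linarith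
  have e : x + s • u = (1 - θ) • (x + r • u) + θ • (x + t • u) := by
    rw [hθ]; module
  calc ‖x + s • u‖ ≤ ‖(1 - θ) • (x + r • u)‖ + ‖θ • (x + t • u)‖ := by rw [e]; exact norm_add_le _ _
    _ = (1 - θ) * ‖x + r • u‖ + θ * ‖x + t • u‖ := by
      rw [norm_smul, norm_smul, Real.norm_of_nonneg (by linarith), Real.norm_of_nonneg h0]
    _ < p := by nlinarith [mul_le_mul_of_nonneg_left ht h0,
        mul_lt_mul_of_pos_left hr (by linarith : 0 < 1 - θ)]

/-- The points at distance `p` from both `0` and `u`. -/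
def equidistantSet {X : Type*} [NormedAddCommGroup X] (p : ℝ) (u : X) : Set X :=
  {x | ‖x‖ = p ∧ ‖x - u‖ = p}

section

/-! ### Points of `equidistantSet p u` on a line parallel to `u` -/

variable {X : Type*} [NormedAddCommGroup X] [NormedSpace ℝ X] {p : ℝ} {u : X}

theorem equidistantSet.not_both_lt {x : X} (hx : x ∈ equidistantSet p u) {k : ℝ}
    (h₁ : ‖x + k • u‖ < p) (h₂ : ‖x + (k - 1) • u‖ < p) : False := by
  have e₀ : ‖x + (0 : ℝ) • u‖ = p := by simpa using hx.1
  have e₁ : ‖x + (-1 : ℝ) • u‖ = p := by simpa [sub_eq_add_neg] using hx.2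
  rcases le_or_gt 1 k with h | h
  · exact (norm_add_smul_lt h₂ e₁.le (s := 0) (Or.inr ⟨by linarith, by linarith⟩)).ne e₀
  rcases le_or_gt 0 k with h' | h'
  · exact (norm_add_smul_lt h₁ h₂.le (s := 0) (Or.inr ⟨by linarith, by linarith⟩)).ne e₀
  rcases le_or_gt k (-1) with h'' | h''
  · exact (norm_add_smul_lt h₁ e₀.le (s := -1) (Or.inl ⟨by linarith, by linarith⟩)).ne e₁
  · exact (norm_add_smul_lt h₂ h₁.le (s := -1) (Or.inl ⟨by linarith, by linarith⟩)).ne e₁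

/-- Shrinking `y` towards `u / 2` gives a point strictly within `p` of both `0` and `u`, which no
line through `x` parallel to `u` can contain. -/
theorem equidistantSet.not_mem_of_scaled (hu : ‖u‖ = p) (hp : 0 < p) {x y : X}
    (hx : x ∈ equidistantSet p u) (hy : y ∈ equidistantSet p u) {s k : ℝ} (hs₀ : 0 ≤ s)
    (hs₁ : s < 1) (h : x + k • u = s • y + ((1 - s) / 2) • u) : False := by
  have hpos : 0 ≤ (1 - s) / 2 := by linarith
  refine equidistantSet.not_both_lt hx (k := k) ?_ ?_
  · calc ‖x + k • u‖ ≤ ‖s • y‖ + ‖((1 - s) / 2) • u‖ := by rw [h]; exact norm_add_le _ _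
      _ = s * p + (1 - s) / 2 * p := by
        rw [norm_smul, norm_smul, Real.norm_of_nonneg hs₀, Real.norm_of_nonneg hpos, hy.1, hu]
      _ < p := by nlinarith
  · have e : x + (k - 1) • u = s • (y - u) - ((1 - s) / 2) • u := by
      have : x + (k - 1) • u = (x + k • u) - u := by module
      rw [this, h]; module
    calc ‖x + (k - 1) • u‖ ≤ ‖s • (y - u)‖ + ‖((1 - s) / 2) • u‖ := by
          rw [e]; exact norm_sub_le _ _
      _ = s * p + (1 - s) / 2 * p := by
        rw [norm_smul, norm_smul, Real.norm_of_nonneg hs₀, Real.norm_of_nonneg hpos, hy.2, hu]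
      _ < p := by nlinarith

theorem norm_add_smul_eq_of_mem_Icc {x : X} {r s t : ℝ} (hp : ‖x + (r - 1) • u‖ = p)
    (hr : ‖x + r • u‖ = p) (ht : ‖x + t • u‖ = p) (hrs : r ≤ s) (hst : s ≤ t) :
    ‖x + s • u‖ = p := by
  rcases hst.eq_or_lt with rfl | hst
  · exact ht
  by_contra hne
  have hlt : ‖x + s • u‖ < p := by
    by_contra! hge
    have hgt := lt_of_le_of_ne hge (Ne.symm hne)
    have h₁ : ‖x + r • u‖ < ‖x + s • u‖ := by rwa [hr]
    exact (norm_add_smul_lt h₁ (ht.trans_lt hgt).le (Or.inl ⟨hrs, hst⟩)).false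
  exact (norm_add_smul_lt hlt hp.le (s := r) (Or.inr ⟨by linarith, hrs⟩)).ne hr

theorem equidistantSet.add_smul_mem {x : X} {r s t : ℝ} (hr : x + r • u ∈ equidistantSet p u)
    (ht : x + t • u ∈ equidistantSet p u) (hrs : r ≤ s) (hst : s ≤ t) :
    x + s • u ∈ equidistantSet p u := by
  have e : ∀ q : ℝ, x + q • u - u = x + (q - 1) • u := fun q => by module
  obtain ⟨hr₁, hr₂⟩ := hr
  obtain ⟨ht₁, ht₂⟩ := ht
  rw [e] at hr₂ ht₂
  refine ⟨norm_add_smul_eq_of_mem_Icc hr₂ hr₁ ht₁ hrs hst, ?_⟩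
  rw [e]
  have hneg : ∀ q : ℝ, x + q • -u = x + (-q) • u := fun q => by module
  -- The distance to `u` follows by symmetry: replace `u` by `-u` and each parameter `q` by `1 - q`.
  have := norm_add_smul_eq_of_mem_Icc (x := x) (u := -u) (p := p) (r := 1 - t) (s := 1 - s)
    (t := 1 - r) (by rw [hneg]; convert ht₁ using 4; ring) (by rw [hneg]; convert ht₂ using 4; ring)
    (by rw [hneg]; convert hr₂ using 4; ring) (by linarith) (by linarith)
  rw [hneg] at this
  convert this using 4; ring

/-! ### Fibres of the projection along `u` -/

variable {Y : Type*} [NormedAddCommGroup Y] [NormedSpace ℝ Y] {f : X →L[ℝ] Y}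

theorem equidistantSet.map_ne_zero (hu : ‖u‖ = p) (hp : 0 < p)
    (hker : ∀ z, f z = 0 → ∃ k : ℝ, z = k • u) {x : X} (hx : x ∈ equidistantSet p u) :
    f x ≠ 0 := by
  intro h0
  obtain ⟨k, rfl⟩ := hker x h0
  obtain ⟨h₁, h₂⟩ := hx
  rw [show k • u - u = (k - 1) • u by module] at h₂
  rw [norm_smul, hu, mul_eq_right₀ hp.ne', Real.norm_eq_abs, abs_eq zero_le_one] at h₁ h₂
  rcases h₁ with rfl | rfl <;> norm_num at h₂

/-- Maximise `‖f x‖` over the points above the ray within `p` of both `0` and `u`. If either bound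
were slack, a small slide along `u` would make both strict, leaving room to move further out. -/
theorem equidistantSet.exists_mem_ray [ProperSpace X] (hu : ‖u‖ = p) (hp : 0 < p) (hfu : f u = 0)
    (hsurj : Function.Surjective f) {v : Y} (hv : ‖v‖ = 1) :
    ∃ x ∈ equidistantSet p u, f x = ‖f x‖ • v := by
  let K : Set X := {x | ‖x‖ ≤ p ∧ ‖x - u‖ ≤ p ∧ f x = ‖f x‖ • v}
  have hKc : IsCompact K := by
    refine (isCompact_closedBall (0 : X) p).of_isClosed_subset ?_ fun x hx => by simpa using hx.1
    have h₁ : IsClosed {x : X | ‖x‖ ≤ p} := isClosed_le (by fun_prop) (by fun_prop)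
    have h₂ : IsClosed {x : X | ‖x - u‖ ≤ p} := isClosed_le (by fun_prop) (by fun_prop)
    have h₃ : IsClosed {x : X | f x = ‖f x‖ • v} := isClosed_eq (by fun_prop) (by fun_prop)
    exact h₁.inter (h₂.inter h₃)
  have hKn : K.Nonempty := by
    refine ⟨(2⁻¹ : ℝ) • u, ?_, ?_, by simp [hfu]⟩
    · rw [norm_smul, hu]; norm_num; linarith
    · rw [show (2⁻¹ : ℝ) • u - u = (-2⁻¹ : ℝ) • u by module, norm_smul, hu]; norm_num; linarith
  obtain ⟨x, hxK, hmax⟩ := hKc.exists_isMaxOn hKn (f := fun x => ‖f x‖) (by fun_prop)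
  obtain ⟨w, hw⟩ := hsurj v
  have key : ∀ y, f y = f x → ¬ (‖y‖ < p ∧ ‖y - u‖ < p) := by
    rintro y hy ⟨h₁, h₂⟩
    have hev : ∀ᶠ ε : ℝ in nhdsWithin 0 (Set.Ioi 0), ‖y + ε • w‖ < p ∧ ‖y + ε • w - u‖ < p := by
      refine Filter.Eventually.filter_mono nhdsWithin_le_nhds ?_
      refine Filter.Eventually.and ?_ ?_
      · exact (by fun_prop : Continuous fun ε : ℝ => ‖y + ε • w‖).continuousAt.eventually_lt
          continuousAt_const (by simpa using h₁)
      · exact (by fun_prop : Continuous fun ε : ℝ => ‖y + ε • w - u‖).continuousAt.eventually_lt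
          continuousAt_const (by simpa using h₂)
    obtain ⟨ε, ⟨h₃, h₄⟩, hε⟩ := (hev.and self_mem_nhdsWithin).exists
    have hε : 0 < ε := hε
    have hf : f (y + ε • w) = (‖f x‖ + ε) • v := by
      rw [map_add, map_smul, hw, hy, add_smul, ← hxK.2.2]
    have hn : ‖f (y + ε • w)‖ = ‖f x‖ + ε := by
      rw [hf, norm_smul, hv, mul_one, Real.norm_of_nonneg (by positivity)]
    have : ‖f (y + ε • w)‖ ≤ ‖f x‖ := hmax (a := y + ε • w) ⟨h₃.le, h₄.le, by rw [hn, hf]⟩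
    linarith
  obtain ⟨hx₁, hx₂, hx₃⟩ := hxK
  have hsub : ∀ s : ℝ, x + s • u - u = x + (s - 1) • u := fun s => by module
  have e₀ : x + (0 : ℝ) • u = x := by simp
  have e₁ : x + (-1 : ℝ) • u = x - u := by simp [sub_eq_add_neg]
  have hmap : ∀ s : ℝ, f (x + s • u) = f x := fun s => by simp [hfu]
  refine ⟨x, ⟨hx₁.eq_of_not_lt fun hlt => ?_, hx₂.eq_of_not_lt fun hlt => ?_⟩, hx₃⟩
  · have hev : ∀ᶠ ε : ℝ in nhdsWithin 0 (Set.Ioo 0 1), ‖x + ε • u‖ < p := by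
      refine Filter.Eventually.filter_mono nhdsWithin_le_nhds ?_
      exact (by fun_prop : Continuous fun ε : ℝ => ‖x + ε • u‖).continuousAt.eventually_lt
          continuousAt_const (by simpa using hlt)
    have : (nhdsWithin (0 : ℝ) (Set.Ioo 0 1)).NeBot := left_nhdsWithin_Ioo_neBot zero_lt_one
    obtain ⟨ε, h₁, hε⟩ := (hev.and self_mem_nhdsWithin).exists
    refine key (x + ε • u) (hmap ε) ⟨h₁, ?_⟩
    rw [hsub]
    exact norm_add_smul_lt (r := 0) (t := -1) (by rwa [e₀]) (by rwa [e₁])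
      (Or.inr ⟨by linarith [hε.1], by linarith [hε.2]⟩)
  · have hev : ∀ᶠ ε : ℝ in nhdsWithin 0 (Set.Ioo 0 1), ‖x - u + (-ε) • u‖ < p := by
      refine Filter.Eventually.filter_mono nhdsWithin_le_nhds ?_
      exact (by fun_prop : Continuous fun ε : ℝ => ‖x - u + (-ε) • u‖).continuousAt.eventually_lt
          continuousAt_const (by simpa using hlt)
    have : (nhdsWithin (0 : ℝ) (Set.Ioo 0 1)).NeBot := left_nhdsWithin_Ioo_neBot zero_lt_one
    obtain ⟨ε, h₁, hε⟩ := (hev.and self_mem_nhdsWithin).exists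
    refine key (x + (-ε) • u) (hmap _) ⟨?_, ?_⟩
    · exact norm_add_smul_lt (r := -1) (t := 0) (by rwa [e₁]) (by rwa [e₀])
        (Or.inl ⟨by linarith [hε.2], by linarith [hε.1]⟩)
    · convert h₁ using 2; module

theorem equidistantSet.convex_ray (hu : ‖u‖ = p) (hp : 0 < p) (hfu : f u = 0)
    (hker : ∀ z, f z = 0 → ∃ k : ℝ, z = k • u) (v : Y) :
    Convex ℝ {x | x ∈ equidistantSet p u ∧ f x = ‖f x‖ • v} := by
  -- All points of the fibre have the same image under `f`, so they lie on one line parallel to `u`.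
  have hle : ∀ {x y : X}, x ∈ equidistantSet p u → f x = ‖f x‖ • v → y ∈ equidistantSet p u →
      f y = ‖f y‖ • v → ‖f y‖ ≤ ‖f x‖ := by
    intro x y hx hxv hy hyv
    by_contra! hlt
    have hypos : 0 < ‖f y‖ := (norm_nonneg _).trans_lt hlt
    have hs₁ : ‖f x‖ / ‖f y‖ < 1 := (div_lt_one hypos).2 hlt
    set s := ‖f x‖ / ‖f y‖ with hs
    obtain ⟨k, hk⟩ := hker (s • y + ((1 - s) / 2) • u - x) (by
      rw [map_sub, map_add, map_smul, map_smul, hfu, smul_zero, add_zero, hxv, hyv, smul_smul,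
        hs, div_mul_cancel₀ _ hypos.ne', sub_self])
    exact equidistantSet.not_mem_of_scaled hu hp hx hy (div_nonneg (norm_nonneg _) hypos.le) hs₁
      (k := k) (by rw [← hk]; abel)
  have hline : ∀ {x : X} {k θ : ℝ}, x ∈ equidistantSet p u → x + k • u ∈ equidistantSet p u →
      0 ≤ θ → θ ≤ 1 → x + (θ * k) • u ∈ equidistantSet p u := by
    intro x k θ hx hk h₀ h₁
    have hx' : x + (0 : ℝ) • u ∈ equidistantSet p u := by simpa using hx
    rcases le_total 0 k with h | h
    · exact equidistantSet.add_smul_mem hx' hk (by positivity) (by nlinarith)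
    · exact equidistantSet.add_smul_mem hk hx' (by nlinarith) (by nlinarith)
  rintro x ⟨hx, hxv⟩ y ⟨hy, hyv⟩ a b ha hb hab
  have hxy : ‖f x‖ = ‖f y‖ := le_antisymm (hle hy hyv hx hxv) (hle hx hxv hy hyv)
  have hfxy : f y = f x := by rw [hxv, hyv, hxy]
  obtain ⟨k, hk⟩ := hker (y - x) (by rw [map_sub, hfxy, sub_self])
  obtain rfl : y = x + k • u := by rw [← hk]; abel
  obtain rfl : a = 1 - b := by linarith
  have e : (1 - b) • x + b • (x + k • u) = x + (b * k) • u := by module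
  rw [e]
  refine ⟨hline hx hy hb (by linarith), ?_⟩
  rw [map_add, map_smul, hfu, smul_zero, add_zero]
  exact hxv

/-! ### Connectedness and the intermediate value argument -/

theorem isClosed_equidistantSet {X : Type*} [NormedAddCommGroup X] (p : ℝ) (u : X) :
    IsClosed (equidistantSet p u) :=
  (isClosed_eq (by fun_prop) (by fun_prop)).inter (isClosed_eq (by fun_prop) (by fun_prop))

theorem isPreconnected_equidistantSet_of_map [ProperSpace X] (hu : ‖u‖ = p) (hp : 0 < p)
    (hfu : f u = 0) (hker : ∀ z, f z = 0 → ∃ k : ℝ, z = k • u) (hsurj : Function.Surjective f)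
    (hY : 1 < Module.rank ℝ Y) : IsPreconnected (equidistantSet p u) := by
  have hcomp : IsCompact (equidistantSet p u) :=
    (isCompact_closedBall (0 : X) p).of_isClosed_subset (isClosed_equidistantSet p u)
      fun x hx => by simpa using hx.1.le
  have : CompactSpace (equidistantSet p u) := isCompact_iff_compactSpace.1 hcomp
  have hne : ∀ x : equidistantSet p u, ‖f x‖ ≠ 0 := fun x =>
    norm_ne_zero_iff.2 (equidistantSet.map_ne_zero hu hp hker x.2)
  let g : equidistantSet p u → Metric.sphere (0 : Y) 1 := fun x =>
    ⟨‖f x‖⁻¹ • f x, by simp [norm_smul, hne x]⟩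
  have hg : Continuous g := by
    refine Continuous.subtype_mk ?_ _
    exact (Continuous.inv₀ (by fun_prop) hne).smul (by fun_prop)
  have hgv : ∀ (x : equidistantSet p u) (v : Metric.sphere (0 : Y) 1),
      g x = v ↔ f x = ‖f x‖ • (v : Y) := by
    intro x v
    rw [Subtype.ext_iff]
    exact inv_smul_eq_iff₀ (hne x)
  have hfib : ∀ v, IsConnected (g ⁻¹' {v}) := by
    intro v
    have hv : ‖(v : Y)‖ = 1 := by simp
    constructor
    · obtain ⟨x, hx, hxv⟩ := equidistantSet.exists_mem_ray hu hp hfu hsurj hv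
      exact ⟨⟨x, hx⟩, (hgv _ _).2 hxv⟩
    · rw [← Topology.IsInducing.subtypeVal.isPreconnected_image]
      convert (equidistantSet.convex_ray hu hp hfu hker (v : Y)).isPreconnected using 1
      ext x
      simp [hgv, and_comm]
  have hgs : Function.Surjective g := fun v => (hfib v).nonempty
  have : ConnectedSpace (Metric.sphere (0 : Y) 1) :=
    isConnected_iff_connectedSpace.1 (isConnected_sphere hY 0 zero_le_one)
  -- A closed quotient map with connected fibres pulls connectedness back from the sphere.
  have := (hg.isClosedMap.isQuotientMap hg hgs).isCoinducing.isConnected_preimage_of_isClosed hfib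
    isClosed_univ isConnected_univ
  rw [Set.preimage_univ] at this
  rw [isPreconnected_iff_preconnectedSpace]
  exact ⟨this.isPreconnected⟩

theorem isPreconnected_equidistantSet (hdim : Module.finrank ℝ X = 3) (hu : ‖u‖ = p)
    (hp : 0 < p) : IsPreconnected (equidistantSet p u) := by
  have : FiniteDimensional ℝ X := FiniteDimensional.of_finrank_pos (by omega)
  have : ProperSpace X := FiniteDimensional.proper ℝ X
  have hu₀ : u ≠ 0 := norm_pos_iff.1 (hu ▸ hp)
  obtain ⟨Y, hY⟩ := Submodule.exists_isCompl (ℝ ∙ u)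
  have hfin := Submodule.finrank_add_eq_of_isCompl hY
  rw [finrank_span_singleton hu₀, hdim] at hfin
  refine isPreconnected_equidistantSet_of_map (Y := Y)
    (f := LinearMap.toContinuousLinearMap (Submodule.projectionOnto Y (ℝ ∙ u) hY.symm)) hu hp
    ?_ ?_ ?_ ?_
  · simp
  · intro z hz
    have hz' : z ∈ ℝ ∙ u := by simpa using hz
    obtain ⟨k, hk⟩ := Submodule.mem_span_singleton.1 hz'
    exact ⟨k, hk.symm⟩
  · exact Submodule.projectionOnto_surjective hY.symm
  · rw [← Module.finrank_eq_rank]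
    exact_mod_cast (by omega : 1 < Module.finrank ℝ Y)

/-- Three points at mutual distance `p` in a three-dimensional normed space have a common
point at distance `p`. -/
theorem exists_equidistant (hdim : Module.finrank ℝ X = 3) (hp : 0 < p) {a b c : X}
    (hab : ‖b - a‖ = p) (hac : ‖c - a‖ = p) (hbc : ‖c - b‖ = p) :
    ∃ d : X, ‖d - a‖ = p ∧ ‖d - b‖ = p ∧ ‖d - c‖ = p := by
  have h₁ : c - a ∈ equidistantSet p (b - a) := ⟨hac, by simpa using hbc⟩
  have h₂ : b - c ∈ equidistantSet p (b - a) :=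
    ⟨by rwa [norm_sub_rev], by rw [← hac, ← norm_neg]; congr 1; abel⟩
  have hfar : p ≤ ‖b - c - (c - a)‖ := by
    have e : (2 : ℝ) • (c - a) = (b - a) - (b - c - (c - a)) := by module
    have := norm_sub_le (b - a) (b - c - (c - a))
    rw [← e, norm_smul, hac, hab, Real.norm_two] at this
    linarith
  obtain ⟨x, hx, hxp⟩ := (isPreconnected_equidistantSet hdim hab hp).intermediate_value h₁ h₂
    (f := fun x => ‖x - (c - a)‖) (by fun_prop) (show p ∈ Set.Icc _ _ by simpa using ⟨hp.le, hfar⟩)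
  refine ⟨x + a, by simpa using hx.1, ?_, ?_⟩
  · rw [← hx.2]; congr 1; abel
  · rw [← hxp]; congr 1; abel

end

theorem theorem1 {X : Type*} [NormedAddCommGroup X] [NormedSpace ℝ X]
    (hdim : Module.finrank ℝ X = 3) :
    (∀ (p : ℝ) (a b c : X), a ≠ b → b ≠ c → a ≠ c →
        IsEquilateralWith p ({a, b, c} : Set X) →
        ∃ d : X, ‖d - a‖ = p ∧ ‖d - b‖ = p ∧ ‖d - c‖ = p) ∧
    (∀ S : Set X, IsEquilateral S → S.ncard = 3 →
        ∃ T : Set X, S ⊆ T ∧ T.ncard = 4 ∧ IsEquilateral T) := by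
  have main : ∀ (p : ℝ) (a b c : X), a ≠ b → b ≠ c → a ≠ c →
      IsEquilateralWith p ({a, b, c} : Set X) →
      ∃ d : X, ‖d - a‖ = p ∧ ‖d - b‖ = p ∧ ‖d - c‖ = p := by
    rintro p a b c hab hbc hac ⟨hp, h⟩
    exact exists_equidistant hdim hp (h b (by simp) a (by simp) hab.symm)
      (h c (by simp) a (by simp) hac.symm) (h c (by simp) b (by simp) hbc.symm)
  refine ⟨main, ?_⟩
  rintro S ⟨p, hS⟩ hcard
  obtain ⟨a, b, c, hab, hac, hbc, rfl⟩ := Set.ncard_eq_three.1 hcard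
  obtain ⟨d, hd⟩ := main p a b c hab hbc hac hS
  have hd' : ∀ x ∈ ({a, b, c} : Set X), ‖d - x‖ = p := by
    rintro x (rfl | rfl | rfl)
    exacts [hd.1, hd.2.1, hd.2.2]
  have hdS : d ∉ ({a, b, c} : Set X) := fun hmem => by
    have := hd' d hmem
    rw [sub_self, norm_zero] at this
    exact hS.1.ne this
  refine ⟨insert d {a, b, c}, Set.subset_insert _ _, ?_, p, hS.1, ?_⟩
  · rw [Set.ncard_insert_of_notMem hdS (by simp), hcard]
  · rintro x (rfl | hx) y (rfl | hy) hxy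
    · exact absurd rfl hxy
    · exact hd' y hy
    · rw [norm_sub_rev]; exact hd' x hx
    · exact hS.2 x hx y hy hxy
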